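/- Fix real numbers $m>1$ and $w^*>0$ and integers $n\ge 2$, $s\ge 1$, $L\ge 3$, and put $d=sn$. Let $$\Omega=\bigcup_{b=1}^{n}\{(i,j): i,j\in\{(b-1)s+1,\dots,bs\}\}\subseteq\{1,\dots,d\}^2,$$ and let $W^*\in\mathbb{R}^{d\times d}$ satisfy $W^*_{ij}=w^*$ for all $(i,j)\in\Omega$ (its other entries are arbitrary). For $W_1,\dots,W_L\in\mathbb{R}^{d\times d}$ write $W_{L:1}=W_LW_{L-1}\cdots W_1$ and $$\phi(W_1,\dots,W_L)=\frac12\sum_{(i,j)\in\Omega}\big((W_{L:1})_{ij}-W^*_{ij}\big)^2 .$$ For $\alpha>0$ consider the gradient flow $$\dot W_l(t)=-\frac{\partial\phi}{\partial W_l}\big(W_1(t),\dots,W_L(t)\big),\qquad t\ge 0,\ 1\le l\le L,$$ where every $W_l(0)$ is the $d\times d$ matrix with diagonal entries $\alpha$ and off-diagonal entries $\alpha/m$. Then for every $\alpha>0$ this flow has a solution on $[0,\infty)$, and there is a matrix $W_{L:1}(\infty)=W_{L:1}^{(\alpha)}(\infty)$ to which $W_{L:1}(t)=W_L(t)\cdots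 W_1(t)$ converges as $t\to\infty$ for every such solution. Moreover, with $m,n,s,w^*,L$ (and $W^*$) fixed, $$\mathrm{srank}\big(W_{L:1}^{(\alpha)}(\infty)\big)\longrightarrow 1\qquad\text{as }\alpha\to 0^+,$$ where $\mathrm{srank}(W)=\|W\|_F^2/\|W\|_2^2$, with $\|\cdot\|_F$ the Frobenius norm and $\|\cdot\|_2$ the spectral norm. -/

import Mathlib

open Filter Topology

namespace DeepCompletion

/-- The end-to-end matrix `W_L * W_{L-1} * ... * W_1` of a depth-`L` linear network with square
factors. The layers are indexed from `0`, so `W 0` is the first layer `W_1`. -/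
def endToEnd {L d : ℕ} (W : Fin L → Matrix (Fin d) (Fin d) ℝ) : Matrix (Fin d) (Fin d) ℝ :=
  (List.ofFn W).reverse.prod

/-- The block-diagonal observation set: the pairs `(i, j)` such that `i` and `j` lie in the same
block `{b * s, ..., (b + 1) * s - 1}`, with `b < n` (indices start at `0`). -/
def blockObs (s n : ℕ) : Finset (Fin (s * n) × Fin (s * n)) :=
  Finset.univ.filter fun p => ∃ b : Fin n,
    ((b : ℕ) * s ≤ (p.1 : ℕ) ∧ (p.1 : ℕ) < ((b : ℕ) + 1) * s) ∧
    ((b : ℕ) * s ≤ (p.2 : ℕ) ∧ (p.2 : ℕ) < ((b : ℕ) + 1) * s)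

/-- The squared error over the observed entries,
`φ(W_1, ..., W_L; Ω) = 1/2 * ∑_{(i,j) ∈ Ω} (w_{ij} - w*_{ij})^2`. -/
noncomputable def loss {L d : ℕ} (Ω : Finset (Fin d × Fin d)) (Wstar : Matrix (Fin d) (Fin d) ℝ)
    (W : Fin L → Matrix (Fin d) (Fin d) ℝ) : ℝ :=
  (1 / 2) * ∑ p ∈ Ω, (endToEnd W p.1 p.2 - Wstar p.1 p.2) ^ 2

/-- The matrix `∂φ/∂W_l` of the partial derivatives of the loss with respect to the entries of the
`l`-th factor. The loss is a polynomial in these entries, so the derivatives exist. -/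
noncomputable def lossGrad {L d : ℕ} (Ω : Finset (Fin d × Fin d))
    (Wstar : Matrix (Fin d) (Fin d) ℝ) (W : Fin L → Matrix (Fin d) (Fin d) ℝ) (l : Fin L) :
    Matrix (Fin d) (Fin d) ℝ :=
  Matrix.of fun i j =>
    deriv (fun x : ℝ => loss Ω Wstar (Function.update W l (W l + x • Matrix.single i j (1 : ℝ)))) 0

/-- `W` solves the gradient flow `dW_l/dt = -∂φ/∂W_l`, for all layers `l` and all times `t ≥ 0`,
and starts at `W0`. The derivative is one-sided at `t = 0`; values at negative times are
irrelevant. -/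
structure IsGradientFlow {L d : ℕ} (Ω : Finset (Fin d × Fin d))
    (Wstar : Matrix (Fin d) (Fin d) ℝ) (W0 : Fin L → Matrix (Fin d) (Fin d) ℝ)
    (W : ℝ → Fin L → Matrix (Fin d) (Fin d) ℝ) : Prop where
  initial : W 0 = W0
  flow : ∀ t : ℝ, 0 ≤ t → ∀ (l : Fin L) (i j : Fin d),
    HasDerivWithinAt (fun τ : ℝ => W τ l i j) (-(lossGrad Ω Wstar (W t) l i j)) (Set.Ici 0) t

/-- The initial value of each factor: `α` on the diagonal and `α / m` off the diagonal. -/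
noncomputable def initFactor (d : ℕ) (α m : ℝ) : Matrix (Fin d) (Fin d) ℝ :=
  Matrix.of fun i j => if i = j then α else α / m

/-- The stable rank `‖W‖_F ^ 2 / ‖W‖_2 ^ 2`: the squared Frobenius norm over the square of the
operator norm on Euclidean space. -/
noncomputable def stableRank {d : ℕ} (W : Matrix (Fin d) (Fin d) ℝ) : ℝ :=
  (∑ i, ∑ j, W i j ^ 2) / ‖Matrix.toEuclideanCLM (𝕜 := ℝ) W‖ ^ 2

end DeepCompletion

namespace DeepCompletion

/-! The initial factors are equal and lie in the commutative algebra spanned by the all-ones matrix,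
the block indicator and the identity. Masking the residual to the blocks keeps it in this algebra,
and so does the gradient (`lossGrad_spectralMatrix`). The flow therefore reduces to three
eigenvalues: `a' = -a^(L-1) r`, `b' = -b^(L-1) r`, `c' = -c^(2L-1)`, with the same residual `r =
(a^L - b^L)/n + b^L - s w`.

In the time `τ` with `τ' = -r`, both `a` and `b` solve `u' = u^(L-1)` explicitly, which leaves one
scalar equation with strictly decreasing right-hand side. Hence `r → 0`, `c → 0`, and `b^(-(L-2)) -
a^(-(L-2))` is conserved (`exists_eigenvalue_flow`). Local Lipschitz uniqueness
(`IsGradientFlow.eqOn`) gives every solution the same limit.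

The conserved quantity is a positive multiple of `α^(-(L-2))`. It blows up as `α → 0`, forcing `b →
0`; then `r = 0` gives `a^L → n s w`. The limits tend to `w` times the all-ones matrix, which has
rank one, and the stable rank is continuous at nonzero matrices. -/

/-! ### Partial derivatives of the loss. -/

theorem endToEnd_succ {L d : ℕ} (W : Fin (L + 1) → Matrix (Fin d) (Fin d) ℝ) :
    endToEnd W = endToEnd (fun l : Fin L => W l.succ) * W 0 := by
  simp [endToEnd, List.ofFn_succ]

theorem endToEnd_const {L d : ℕ} (A : Matrix (Fin d) (Fin d) ℝ) :
    endToEnd (fun _ : Fin L => A) = A ^ L := by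
  simp [endToEnd]

/-- The end-to-end matrix is a linear function of each single factor. -/
theorem exists_endToEnd_update_eq {L d : ℕ} (W : Fin L → Matrix (Fin d) (Fin d) ℝ) (l : Fin L) :
    ∃ U V : Matrix (Fin d) (Fin d) ℝ,
      (∀ M, endToEnd (Function.update W l M) = U * M * V) ∧
      ∀ A, (∀ k, W k = A) → U = A ^ (L - 1 - (l : ℕ)) ∧ V = A ^ (l : ℕ) := by
  induction L with
  | zero => exact l.elim0
  | succ L ih =>
    refine Fin.cases ?_ (fun k => ?_) l
    · refine ⟨endToEnd (fun l : Fin L => W l.succ), 1, fun M => ?_, fun A hA => ?_⟩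
      · simp [endToEnd_succ]
      · have : (fun l : Fin L => W l.succ) = fun _ => A := funext fun l => hA _
        rw [this, endToEnd_const]
        simp
    · obtain ⟨U, V, h1, h2⟩ := ih (fun l => W l.succ) k
      refine ⟨U, V * W 0, fun M => ?_, fun A hA => ?_⟩
      · have hupd : (fun j : Fin L => Function.update W k.succ M j.succ) =
            Function.update (fun j : Fin L => W j.succ) k M := by
          funext j
          by_cases hj : j = k
          · subst hj; simp
          · rw [Function.update_of_ne hj, Function.update_of_ne (by simpa using hj)]
        rw [endToEnd_succ, ← mul_assoc, ← h1, hupd, Function.update_of_ne (Fin.succ_ne_zero k).symm]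
      · obtain ⟨hU, hV⟩ := h2 A fun k => hA _
        refine ⟨?_, ?_⟩
        · rw [hU, Fin.val_succ]; congr 1; omega
        · rw [hV, hA 0, Fin.val_succ, pow_succ]

/-- The product is affine in a single entry of one factor, so the loss is quadratic along that
entry. -/
theorem lossGrad_apply {L d : ℕ} (Ω : Finset (Fin d × Fin d))
    (Wstar : Matrix (Fin d) (Fin d) ℝ) (W : Fin L → Matrix (Fin d) (Fin d) ℝ) (l : Fin L)
    (i j : Fin d) :
    lossGrad Ω Wstar W l i j = ∑ p ∈ Ω, (endToEnd W p.1 p.2 - Wstar p.1 p.2) *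
      endToEnd (Function.update W l (Matrix.single i j 1)) p.1 p.2 := by
  obtain ⟨U, V, hUV, -⟩ := exists_endToEnd_update_eq W l
  have hW : endToEnd W = U * W l * V := by
    rw [← hUV, Function.update_eq_self]
  have key : ∀ x : ℝ, endToEnd (Function.update W l (W l + x • Matrix.single i j (1 : ℝ))) =
      endToEnd W + x • endToEnd (Function.update W l (Matrix.single i j 1)) := by
    intro x
    rw [hUV, hUV, hW, mul_add, add_mul, mul_smul_comm, smul_mul_assoc]
  simp only [lossGrad, Matrix.of_apply, loss, key, Matrix.add_apply, Matrix.smul_apply,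
    smul_eq_mul]
  apply HasDerivAt.deriv
  have hp : ∀ p ∈ Ω, HasDerivAt (fun x : ℝ => (endToEnd W p.1 p.2 +
      x * endToEnd (Function.update W l (Matrix.single i j 1)) p.1 p.2 - Wstar p.1 p.2) ^ 2)
      (2 * ((endToEnd W p.1 p.2 - Wstar p.1 p.2) *
        endToEnd (Function.update W l (Matrix.single i j 1)) p.1 p.2)) 0 := by
    intro p _
    refine ((((hasDerivAt_id (0 : ℝ)).mul_const _).const_add _).sub_const _ |>.pow 2).congr_deriv ?_
    simp
    ring
  refine ((HasDerivAt.fun_sum hp).const_mul (1 / 2)).congr_deriv ?_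
  rw [← Finset.mul_sum]
  ring

/-! ### The algebra of all-ones, block-ones and identity matrices. -/

/-- The indicator matrix of the relation `i / s = j / s`. -/
def blockOnes (s n : ℕ) : Matrix (Fin (s * n)) (Fin (s * n)) ℝ :=
  Matrix.of fun i j => if (i : ℕ) / s = (j : ℕ) / s then 1 else 0

/-- The matrix all of whose entries are one. -/
def allOnes (d : ℕ) : Matrix (Fin d) (Fin d) ℝ := Matrix.of fun _ _ => 1

theorem mem_blockObs {s n : ℕ} (hs : 1 ≤ s) (p : Fin (s * n) × Fin (s * n)) :
    p ∈ blockObs s n ↔ (p.1 : ℕ) / s = (p.2 : ℕ) / s := by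
  have key : ∀ b k : ℕ, (b * s ≤ k ∧ k < (b + 1) * s) ↔ k / s = b := by
    intro b k
    rw [Nat.div_eq_iff (by omega), add_mul]
    omega
  simp only [blockObs, Finset.mem_filter, Finset.mem_univ, true_and, key]
  constructor
  · rintro ⟨b, h1, h2⟩
    rw [h1, h2]
  · intro h
    exact ⟨⟨(p.1 : ℕ) / s, Nat.div_lt_of_lt_mul p.1.2⟩, rfl, h.symm⟩

theorem sum_block_eq {s n : ℕ} (hs : 1 ≤ s) {c : ℕ} (hc : c < n) :
    ∑ k : Fin (s * n), (if c = (k : ℕ) / s then (1 : ℝ) else 0) = s := by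
  rw [Fin.sum_univ_eq_sum_range (fun k => if c = k / s then (1 : ℝ) else 0) (s * n),
    Finset.sum_boole]
  have : (Finset.range (s * n)).filter (fun k => c = k / s) = Finset.Ico (c * s) ((c + 1) * s) := by
    ext k
    have h1 : (c + 1) * s ≤ n * s := Nat.mul_le_mul_right _ hc
    rw [Finset.mem_filter, Finset.mem_range, Finset.mem_Ico, eq_comm, Nat.div_eq_iff (by omega),
      mul_comm s n]
    rw [add_mul] at *
    omega
  rw [this, Nat.card_Ico, add_mul]
  simp

theorem blockOnes_mul_blockOnes {s n : ℕ} (hs : 1 ≤ s) :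
    blockOnes s n * blockOnes s n = (s : ℝ) • blockOnes s n := by
  ext i j
  simp only [Matrix.mul_apply, blockOnes, Matrix.of_apply, Matrix.smul_apply, smul_eq_mul]
  rw [← sum_block_eq hs (Nat.div_lt_of_lt_mul i.2), Finset.sum_mul]
  refine Finset.sum_congr rfl fun k _ => ?_
  by_cases h : (i : ℕ) / s = (k : ℕ) / s <;> simp [h]

theorem allOnes_mul_allOnes (d : ℕ) : allOnes d * allOnes d = (d : ℝ) • allOnes d := by
  ext i j
  simp [Matrix.mul_apply, allOnes]

theorem blockOnes_mul_allOnes {s n : ℕ} (hs : 1 ≤ s) :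
    blockOnes s n * allOnes (s * n) = (s : ℝ) • allOnes (s * n) := by
  ext i j
  simp only [Matrix.mul_apply, blockOnes, allOnes, Matrix.of_apply, Matrix.smul_apply, smul_eq_mul,
    mul_one]
  exact sum_block_eq hs (Nat.div_lt_of_lt_mul i.2)

theorem transpose_blockOnes (s n : ℕ) : (blockOnes s n).transpose = blockOnes s n := by
  ext i j
  simp [blockOnes, eq_comm]

theorem transpose_allOnes (d : ℕ) : (allOnes d).transpose = allOnes d := by
  ext i j
  simp [allOnes]

theorem allOnes_mul_blockOnes {s n : ℕ} (hs : 1 ≤ s) :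
    allOnes (s * n) * blockOnes s n = (s : ℝ) • allOnes (s * n) := by
  have := congrArg Matrix.transpose (blockOnes_mul_allOnes (n := n) hs)
  simpa [Matrix.transpose_mul, transpose_blockOnes, transpose_allOnes] using this

/-- The symmetric matrix with eigenvalue `a` on the constant vectors, `b` on the block-constant
vectors of mean zero and `c` on the vectors with mean zero on each block. -/
noncomputable def spectralMatrix (s n : ℕ) (a b c : ℝ) : Matrix (Fin (s * n)) (Fin (s * n)) ℝ :=
  ((a - b) / (s * n)) • allOnes (s * n) + ((b - c) / s) • blockOnes s n + c • 1

/-- The eigenspaces do not depend on the eigenvalues, so eigenvalues multiply. The check compares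
coefficients of the three spanning matrices. -/
theorem spectralMatrix_mul {s n : ℕ} (hs : 1 ≤ s) (hn : 1 ≤ n) (a b c a' b' c' : ℝ) :
    spectralMatrix s n a b c * spectralMatrix s n a' b' c' =
      spectralMatrix s n (a * a') (b * b') (c * c') := by
  have hs' : (s : ℝ) ≠ 0 := by positivity
  have hn' : (n : ℝ) ≠ 0 := by positivity
  simp only [spectralMatrix, add_mul, mul_add, smul_mul_assoc, mul_smul_comm, smul_smul,
    allOnes_mul_allOnes, blockOnes_mul_blockOnes hs, blockOnes_mul_allOnes hs,
    allOnes_mul_blockOnes hs, one_mul, mul_one]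
  match_scalars <;> field_simp <;> ring

theorem spectralMatrix_one (s n : ℕ) : spectralMatrix s n 1 1 1 = 1 := by
  simp [spectralMatrix]

theorem spectralMatrix_pow {s n : ℕ} (hs : 1 ≤ s) (hn : 1 ≤ n) (a b c : ℝ) (k : ℕ) :
    spectralMatrix s n a b c ^ k = spectralMatrix s n (a ^ k) (b ^ k) (c ^ k) := by
  induction k with
  | zero => simp [spectralMatrix_one]
  | succ k ih => rw [pow_succ, ih, spectralMatrix_mul hs hn, pow_succ, pow_succ, pow_succ]

theorem transpose_spectralMatrix (s n : ℕ) (a b c : ℝ) :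
    (spectralMatrix s n a b c).transpose = spectralMatrix s n a b c := by
  simp [spectralMatrix, transpose_allOnes, transpose_blockOnes]

theorem initFactor_eq_spectralMatrix {s n : ℕ} (hs : 1 ≤ s) (hn : 1 ≤ n) (α m : ℝ) :
    initFactor (s * n) α m =
      spectralMatrix s n (α - α / m + s * n * (α / m)) (α - α / m) (α - α / m) := by
  have hs' : (s : ℝ) ≠ 0 := by positivity
  have hn' : (n : ℝ) ≠ 0 := by positivity
  ext i j
  by_cases h : i = j
  · subst h
    simp [initFactor, spectralMatrix, allOnes]
    field_simp
    ring
  · simp [initFactor, spectralMatrix, allOnes, h]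
    field_simp

/-! ### The gradient at equal spectral factors. -/

/-- The observed residual of a spectral matrix is again a spectral matrix. -/
theorem ite_spectralMatrix_sub {s n : ℕ} (hs : 1 ≤ s) (hn : 1 ≤ n) (a b c w : ℝ)
    (i j : Fin (s * n)) :
    (if (i : ℕ) / s = (j : ℕ) / s then spectralMatrix s n a b c i j - w else 0) =
      spectralMatrix s n ((a - b) / n + b - s * w) ((a - b) / n + b - s * w) c i j := by
  have hs' : (s : ℝ) ≠ 0 := by positivity
  have hn' : (n : ℝ) ≠ 0 := by positivity
  by_cases h : (i : ℕ) / s = (j : ℕ) / s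
  · simp only [spectralMatrix, allOnes, blockOnes, Matrix.add_apply, Matrix.smul_apply,
      Matrix.of_apply, h, if_true, smul_eq_mul]
    field_simp
    ring
  · have h' : i ≠ j := fun e => h (by rw [e])
    simp [spectralMatrix, allOnes, blockOnes, h, h']

theorem mul_single_mul_apply {ι : Type*} [Fintype ι] [DecidableEq ι] (U V : Matrix ι ι ℝ)
    (i j p q : ι) : (U * Matrix.single i j (1 : ℝ) * V) p q = U p i * V j q := by
  simp only [Matrix.mul_apply, Matrix.single_apply]
  rw [Finset.sum_eq_single j _ (by simp)]
  · simp
  · intro k _ hk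
    simp [hk.symm]

/-- The sum is the Frobenius pairing of `G` with `U E_ij V`; moving `U` and `V` to the other side
transposes them. -/
theorem sum_mul_mul_single_mul {ι : Type*} [Fintype ι] [DecidableEq ι] (Ω : Finset (ι × ι))
    (R : ι × ι → ℝ) (U V G : Matrix ι ι ℝ)
    (hG : ∀ p ∈ Ω, G p.1 p.2 = R p) (hG' : ∀ p ∉ Ω, G p.1 p.2 = 0) (i j : ι) :
    ∑ p ∈ Ω, R p * (U * Matrix.single i j (1 : ℝ) * V) p.1 p.2 =
      (U.transpose * G * V.transpose) i j := by
  calc _ = ∑ p ∈ Ω, G p.1 p.2 * (U p.1 i * V j p.2) :=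
        Finset.sum_congr rfl fun p hp => by rw [hG p hp, mul_single_mul_apply]
    _ = ∑ p : ι × ι, G p.1 p.2 * (U p.1 i * V j p.2) :=
        Finset.sum_subset (Finset.subset_univ _) fun p _ hp => by rw [hG' p hp, zero_mul]
    _ = _ := by
        rw [Fintype.sum_prod_type, Finset.sum_comm]
        simp only [Matrix.mul_apply, Matrix.transpose_apply, Finset.sum_mul]
        exact Finset.sum_congr rfl fun q _ => Finset.sum_congr rfl fun p _ => by ring

/-- The factors around layer `l` are symmetric powers with exponents summing to `L - 1`, and
everything commutes. The gradient is thus the same for every layer, so equal layers stay equal. -/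
theorem lossGrad_spectralMatrix {s n : ℕ} (hs : 1 ≤ s) (hn : 1 ≤ n) {L : ℕ} {w : ℝ}
    {Wstar : Matrix (Fin (s * n)) (Fin (s * n)) ℝ}
    (hWstar : ∀ p ∈ blockObs s n, Wstar p.1 p.2 = w) (a b c : ℝ) (l : Fin L) :
    lossGrad (blockObs s n) Wstar (fun _ => spectralMatrix s n a b c) l =
      spectralMatrix s n (a ^ (L - 1) * ((a ^ L - b ^ L) / n + b ^ L - s * w))
        (b ^ (L - 1) * ((a ^ L - b ^ L) / n + b ^ L - s * w)) (c ^ (L - 1) * c ^ L) := by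
  obtain ⟨U, V, hUV, h2⟩ := exists_endToEnd_update_eq (fun _ : Fin L => spectralMatrix s n a b c) l
  obtain ⟨hU, hV⟩ := h2 _ fun _ => rfl
  have hUt : U.transpose = U := by
    rw [hU, Matrix.transpose_pow, transpose_spectralMatrix]
  have hVt : V.transpose = V := by
    rw [hV, Matrix.transpose_pow, transpose_spectralMatrix]
  set G := spectralMatrix s n ((a ^ L - b ^ L) / n + b ^ L - s * w)
    ((a ^ L - b ^ L) / n + b ^ L - s * w) (c ^ L) with hG
  have hl : L - 1 - (l : ℕ) + l = L - 1 := by omega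
  have key : lossGrad (blockObs s n) Wstar (fun _ => spectralMatrix s n a b c) l =
      U.transpose * G * V.transpose := by
    ext i j
    rw [lossGrad_apply, endToEnd_const, spectralMatrix_pow hs hn, hUV]
    refine sum_mul_mul_single_mul _ _ U V G (fun p hp => ?_) (fun p hp => ?_) i j
    · rw [hG, ← ite_spectralMatrix_sub hs hn, if_pos ((mem_blockObs hs p).1 hp), hWstar p hp]
    · rw [hG, ← ite_spectralMatrix_sub hs hn, if_neg (mt (mem_blockObs hs p).2 hp)]
  rw [key, hUt, hVt, hU, hV, spectralMatrix_pow hs hn, spectralMatrix_pow hs hn, hG,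
    spectralMatrix_mul hs hn, spectralMatrix_mul hs hn]
  congr 1 <;> rw [mul_right_comm, ← pow_add, hl]

/-! ### Scalar autonomous equations. -/

open Set in
/-- A bounded Lipschitz vector field on the line has a solution on `[0, ∞)` from every point. -/
theorem exists_forall_hasDerivWithinAt_Ici {f : ℝ → ℝ} {K M : NNReal} (hf : LipschitzWith K f)
    (hM : ∀ x, ‖f x‖ ≤ M) (x₀ : ℝ) :
    ∃ x : ℝ → ℝ, x 0 = x₀ ∧ ∀ t, 0 ≤ t → HasDerivWithinAt x (f (x t)) (Ici 0) t := by
  -- A field bounded by `M` moves a point by at most `M (N + 1)` in time `N + 1`, so a ball of that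
  -- radius lets Picard–Lindelöf cover the whole interval.
  have hloc : ∀ N : ℕ, ∃ x : ℝ → ℝ, x 0 = x₀ ∧ ∀ t ∈ Icc (0 : ℝ) (N + 1),
      HasDerivWithinAt x (f (x t)) (Icc (0 : ℝ) (N + 1)) t := by
    intro N
    have h0 : (0 : ℝ) ∈ Icc (0 : ℝ) (N + 1) := ⟨le_rfl, by positivity⟩
    have hpl : IsPicardLindelof (fun _ => f) (⟨0, h0⟩ : Icc (0 : ℝ) (N + 1)) x₀
        (M * (N + 1)) 0 M K :=
      { lipschitzOnWith := fun _ _ => hf.lipschitzOnWith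
        continuousOn := fun _ _ => continuousOn_const
        norm_le := fun _ _ x _ => hM x
        mul_max_le := by
          have : (0 : ℝ) ≤ N + 1 := by positivity
          simp [this] }
    exact hpl.exists_eq_forall_mem_Icc_hasDerivWithinAt₀
  choose y hy0 hy using hloc
  have hcont : ∀ N, ContinuousOn (y N) (Icc (0 : ℝ) (N + 1)) :=
    fun N t ht => (hy N t ht).continuousWithinAt
  have hright : ∀ N : ℕ, ∀ T : ℝ, T ≤ N + 1 → ∀ t ∈ Ico (0 : ℝ) T,
      HasDerivWithinAt (y N) (f (y N t)) (Ici t) t := by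
    intro N T hT t ht
    refine (hy N t ⟨ht.1, ht.2.le.trans hT⟩).mono_of_mem_nhdsWithin ?_
    exact mem_of_superset (Icc_mem_nhdsGE (ht.2.trans_le hT)) (Icc_subset_Icc_left ht.1)
  have hagree : ∀ N N' : ℕ, N ≤ N' → EqOn (y N) (y N') (Icc (0 : ℝ) (N + 1)) := by
    intro N N' h
    have hc : (N : ℝ) + 1 ≤ N' + 1 := by exact_mod_cast Nat.succ_le_succ h
    exact ODE_solution_unique (v := fun _ => f) (fun _ => hf) (hcont N)
      (hright N _ le_rfl) ((hcont N').mono (Icc_subset_Icc_right hc)) (hright N' _ hc)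
      ((hy0 N).trans (hy0 N').symm)
  have hglue : ∀ N : ℕ, ∀ t ∈ Ico (0 : ℝ) (N + 1), y ⌊t⌋₊ t = y N t := by
    intro N t ht
    refine hagree _ _ ?_ ⟨ht.1, (Nat.lt_floor_add_one t).le⟩
    have := (Nat.floor_lt ht.1).2 (by exact_mod_cast ht.2 : t < ((N + 1 : ℕ) : ℝ))
    omega
  -- The piece of index `⌊t⌋₊` lives on `[0, ⌊t⌋₊ + 1]`, so `t` is never its right endpoint.
  refine ⟨fun t => y ⌊t⌋₊ t, by simp [hy0], fun t ht => ?_⟩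
  have hlt : t < (⌊t⌋₊ : ℝ) + 1 := Nat.lt_floor_add_one t
  have hmem : Ico (0 : ℝ) (⌊t⌋₊ + 1) ∈ 𝓝[Ici 0] t := by
    rw [← Ici_inter_Iio]
    exact inter_mem self_mem_nhdsWithin (mem_nhdsWithin_of_mem_nhds (Iio_mem_nhds hlt))
  have h1 : HasDerivWithinAt (y ⌊t⌋₊) (f (y ⌊t⌋₊ t)) (Ici 0) t :=
    (hy _ t ⟨ht, hlt.le⟩).mono_of_mem_nhdsWithin (mem_of_superset hmem Ico_subset_Icc_self)
  refine h1.congr_of_eventuallyEq ?_ rfl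
  filter_upwards [hmem] with r hr using hglue _ r hr

open Set in
/-- A scalar autonomous equation with strictly decreasing right-hand side that points inwards at
both ends of an interval has a solution in that interval, and it converges to the equilibrium. -/
theorem exists_solution_tendsto_zero_of_deriv_neg {F F' : ℝ → ℝ} {a b x₀ : ℝ} (ha : a ≤ x₀)
    (hb : x₀ ≤ b) (hF : ∀ x ∈ Icc a b, HasDerivAt F (F' x) x) (hF' : ContinuousOn F' (Icc a b))
    (hneg : ∀ x ∈ Icc a b, F' x < 0) (hFa : 0 < F a) (hFb : F b < 0) :
    ∃ (x : ℝ → ℝ) (y : ℝ), x 0 = x₀ ∧ (∀ t, 0 ≤ t → x t ∈ Icc a b) ∧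
      (∀ t, 0 ≤ t → HasDerivWithinAt x (F (x t)) (Ici 0) t) ∧
      y ∈ Icc a b ∧ F y = 0 ∧ Tendsto x atTop (𝓝 y) := by
  have hab : a ≤ b := ha.trans hb
  have hne : (Icc a b).Nonempty := nonempty_Icc.2 hab
  have hFc : ContinuousOn F (Icc a b) := fun x hx => (hF x hx).continuousAt.continuousWithinAt
  obtain ⟨M, hM⟩ := isCompact_Icc.exists_bound_of_continuousOn hFc
  obtain ⟨K, hK⟩ := isCompact_Icc.exists_bound_of_continuousOn hF'
  obtain ⟨z, hz, hzmax⟩ := isCompact_Icc.exists_isMaxOn hne hF'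
  have hcpos : 0 < -F' z := neg_pos.2 (hneg z hz)
  set c := -F' z with hc
  have hlip : LipschitzOnWith K.toNNReal F (Icc a b) :=
    (convex_Icc a b).lipschitzOnWith_of_nnnorm_hasDerivWithin_le
      (fun x hx => (hF x hx).hasDerivWithinAt) fun x hx => by
        rw [← NNReal.coe_le_coe, coe_nnnorm]
        exact (hK x hx).trans (Real.le_coe_toNNReal K)
  -- Precomposing with the projection onto `[a, b]` makes the field globally bounded and Lipschitz;
  -- the barriers at `a` and `b` then show that the projection never acts.
  have hproj : LipschitzWith (K.toNNReal * 1) (fun x => F (projIcc a b hab x)) :=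
    hlip.to_restrict.comp (LipschitzWith.projIcc hab)
  obtain ⟨x, hx0, hx⟩ := exists_forall_hasDerivWithinAt_Ici hproj (M := M.toNNReal)
    (fun x => (hM _ (projIcc a b hab x).2).trans (Real.le_coe_toNNReal M)) x₀
  have hxc : ∀ T, ContinuousOn x (Icc 0 T) :=
    fun T t ht => (hx t ht.1).continuousWithinAt.mono Icc_subset_Ici_self
  have hmem : ∀ t, 0 ≤ t → x t ∈ Icc a b := by
    intro T hT
    constructor
    · have := image_le_of_deriv_right_lt_deriv_boundary (f := fun t => -x t) (a := 0) (b := T)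
        (f' := fun t => -F (projIcc a b hab (x t))) (hxc T).neg
        (fun t ht => ((hx t ht.1).mono (Ici_subset_Ici.2 ht.1)).neg)
        (B := fun _ => -a) (B' := fun _ => 0) (by simp only [hx0]; linarith)
        (fun t => hasDerivAt_const t _) (fun t _ h => by
          have : x t = a := neg_injective h
          simpa [this] using hFa) ⟨hT, le_rfl⟩
      exact neg_le_neg_iff.1 this
    · exact image_le_of_deriv_right_lt_deriv_boundary (f := x) (a := 0) (b := T)
        (f' := fun t => F (projIcc a b hab (x t))) (hxc T)
        (fun t ht => (hx t ht.1).mono (Ici_subset_Ici.2 ht.1))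
        (B := fun _ => b) (B' := fun _ => 0) (by rw [hx0]; exact hb)
        (fun t => hasDerivAt_const t _) (fun t _ h => by
          have : x t = b := h
          simpa [this] using hFb) ⟨hT, le_rfl⟩
  have hderiv : ∀ t, 0 ≤ t → HasDerivWithinAt x (F (x t)) (Ici 0) t := by
    intro t ht
    have := hx t ht
    rwa [projIcc_of_mem hab (hmem t ht)] at this
  obtain ⟨y, hy, hFy⟩ : ∃ y ∈ Icc a b, F y = 0 :=
    intermediate_value_Icc' hab hFc ⟨hFb.le, hFa.le⟩
  have hmono : ∀ u ∈ Icc a b, ∀ v ∈ Icc a b, u ≤ v → F v - F u ≤ -c * (v - u) := by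
    intro u hu v hv huv
    refine (convex_Icc a b).image_sub_le_mul_sub_of_deriv_le hFc
      (fun r hr => (hF r (interior_subset hr)).differentiableAt.differentiableWithinAt)
      (fun r hr => ?_) u hu v hv huv
    rw [(hF r (interior_subset hr)).deriv, hc, neg_neg]
    exact hzmax (interior_subset hr)
  have hdiss : ∀ u ∈ Icc a b, (u - y) * F u ≤ -c * (u - y) ^ 2 := by
    intro u hu
    rcases le_total u y with h | h
    · have := hmono u hu y hy h
      nlinarith
    · have := hmono y hy u hu h
      nlinarith
  -- Since `F' ≤ -c` by compactness, the squared distance to the equilibrium decays at least like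
  -- `exp (-2ct)`.
  have hanti : AntitoneOn (fun t => (x t - y) ^ 2 * Real.exp (2 * c * t)) (Ici 0) := by
    have hd : ∀ t, 0 ≤ t → HasDerivWithinAt (fun t => (x t - y) ^ 2 * Real.exp (2 * c * t))
        (2 * ((x t - y) * F (x t) + c * (x t - y) ^ 2) * Real.exp (2 * c * t)) (Ici 0) t := by
      intro t ht
      have h1 := ((hderiv t ht).sub_const y).pow 2
      have h2 := ((hasDerivAt_id t).const_mul (2 * c)).exp.hasDerivWithinAt (s := Ici 0)
      refine (h1.mul h2).congr_deriv ?_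
      simp
      ring
    refine antitoneOn_of_hasDerivWithinAt_nonpos (convex_Ici 0)
      (fun t ht => (hd t ht).continuousWithinAt)
      (fun t ht => (hd t (interior_subset ht)).mono interior_subset) fun t ht => ?_
    have := hdiss (x t) (hmem t (interior_subset ht))
    exact mul_nonpos_of_nonpos_of_nonneg (by linarith) (Real.exp_pos _).le
  refine ⟨x, y, hx0, hmem, hderiv, hy, hFy, ?_⟩
  have hexp : Tendsto (fun t => (x₀ - y) ^ 2 * Real.exp (-(2 * c * t))) atTop (𝓝 0) := by
    have : Tendsto (fun t : ℝ => 2 * c * t) atTop atTop :=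
      tendsto_id.const_mul_atTop (by positivity)
    simpa using (Real.tendsto_exp_neg_atTop_nhds_zero.comp this).const_mul ((x₀ - y) ^ 2)
  have hsq : Tendsto (fun t => (x t - y) ^ 2) atTop (𝓝 0) := by
    refine tendsto_of_tendsto_of_tendsto_of_le_of_le' tendsto_const_nhds hexp
      (Eventually.of_forall fun t => sq_nonneg _) ?_
    filter_upwards [eventually_ge_atTop 0] with t ht
    have := hanti (mem_Ici.2 le_rfl) ht ht
    simp only [hx0, mul_zero, Real.exp_zero, mul_one] at this
    rw [Real.exp_neg, ← div_eq_mul_inv, le_div_iff₀ (Real.exp_pos _)]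
    exact this
  have habs : Tendsto (fun t => |x t - y|) atTop (𝓝 0) := by
    have := hsq.sqrt
    simpa [Real.sqrt_sq_eq_abs] using this
  exact tendsto_sub_nhds_zero_iff.1 ((tendsto_zero_iff_abs_tendsto_zero _).2 habs)

/-! ### Uniqueness of the gradient flow. -/

theorem contDiff_endToEnd {E : Type*} [NormedAddCommGroup E] [NormedSpace ℝ E] {L d : ℕ}
    {f : E → Fin L → Matrix (Fin d) (Fin d) ℝ}
    (hf : ∀ l i j, ContDiff ℝ 1 fun x => f x l i j) (i j : Fin d) :
    ContDiff ℝ 1 fun x => endToEnd (f x) i j := by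
  induction L generalizing i j with
  | zero => simpa [endToEnd] using contDiff_const
  | succ L ih =>
    simp only [endToEnd_succ, Matrix.mul_apply]
    exact ContDiff.sum fun k _ => (ih (fun l i j => hf l.succ i j) i k).mul (hf 0 k j)

theorem contDiff_lossGrad {E : Type*} [NormedAddCommGroup E] [NormedSpace ℝ E] {L d : ℕ}
    (Ω : Finset (Fin d × Fin d)) (Wstar : Matrix (Fin d) (Fin d) ℝ)
    {f : E → Fin L → Matrix (Fin d) (Fin d) ℝ}
    (hf : ∀ l i j, ContDiff ℝ 1 fun x => f x l i j) (l : Fin L) (i j : Fin d) :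
    ContDiff ℝ 1 fun x => lossGrad Ω Wstar (f x) l i j := by
  simp only [lossGrad_apply]
  refine ContDiff.sum fun p _ => ((contDiff_endToEnd hf _ _).sub contDiff_const).mul
    (contDiff_endToEnd (fun k a b => ?_) _ _)
  by_cases h : k = l
  · subst h
    simpa using contDiff_const
  · simpa only [Function.update_of_ne h] using hf k a b

open Set in
/-- The gradient flow with a given initial value is unique. -/
theorem IsGradientFlow.eqOn {L d : ℕ} {Ω : Finset (Fin d × Fin d)}
    {Wstar : Matrix (Fin d) (Fin d) ℝ} {W0 : Fin L → Matrix (Fin d) (Fin d) ℝ}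
    {W W' : ℝ → Fin L → Matrix (Fin d) (Fin d) ℝ} (h : IsGradientFlow Ω Wstar W0 W)
    (h' : IsGradientFlow Ω Wstar W0 W') : EqOn W W' (Ici 0) := by
  let v : (Fin L → Fin d → Fin d → ℝ) → Fin L → Fin d → Fin d → ℝ :=
    fun X l i j => -lossGrad Ω Wstar (fun l => Matrix.of (X l)) l i j
  have hv : ContDiff ℝ 1 v := by
    refine contDiff_pi.2 fun l => contDiff_pi.2 fun i => contDiff_pi.2 fun j => ?_
    have hc : ∀ (k : Fin L) (a b : Fin d),
        ContDiff ℝ 1 fun X : Fin L → Fin d → Fin d → ℝ => Matrix.of (X k) a b := by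
      intro k a b
      simp only [Matrix.of_apply]
      fun_prop
    exact (contDiff_lossGrad Ω Wstar hc l i j).neg
  have hflow : ∀ {V : ℝ → Fin L → Fin d → Fin d → ℝ},
      IsGradientFlow Ω Wstar W0 (fun t l => Matrix.of (V t l)) →
      ∀ t, 0 ≤ t → HasDerivWithinAt V (v (V t)) (Ici 0) t := by
    intro V hV t ht
    rw [hasDerivWithinAt_pi]
    intro l
    rw [hasDerivWithinAt_pi]
    intro i
    rw [hasDerivWithinAt_pi]
    intro j
    exact hV.flow t ht l i j
  have hcont : ∀ {V : ℝ → Fin L → Fin d → Fin d → ℝ},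
      IsGradientFlow Ω Wstar W0 (fun t l => Matrix.of (V t l)) →
      ∀ T, ContinuousOn V (Icc 0 T) := fun hV T t ht =>
    (hflow hV t ht.1).continuousWithinAt.mono Icc_subset_Ici_self
  intro T hT
  let X : ℝ → Fin L → Fin d → Fin d → ℝ := W
  let X' : ℝ → Fin L → Fin d → Fin d → ℝ := W'
  replace h : IsGradientFlow Ω Wstar W0 (fun t l => Matrix.of (X t l)) := h
  replace h' : IsGradientFlow Ω Wstar W0 (fun t l => Matrix.of (X' t l)) := h'
  -- On `[0, T]` both solutions stay in a compact ball, where the `C^1` field is Lipschitz.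
  obtain ⟨R, hR⟩ := isCompact_Icc.exists_bound_of_continuousOn (hcont h T)
  obtain ⟨R', hR'⟩ := isCompact_Icc.exists_bound_of_continuousOn (hcont h' T)
  obtain ⟨K, hK⟩ := (hv.locallyLipschitz.locallyLipschitzOn
    (s := Metric.closedBall 0 (max R R'))).exists_lipschitzOnWith_of_compact
      (isCompact_closedBall _ _)
  exact ODE_solution_unique_of_mem_Icc_right (f := X) (g := X')
    (v := fun _ => v) (s := fun _ => Metric.closedBall 0 (max R R')) (fun _ _ => hK)
    (hcont h T) (fun t ht => (hflow h t ht.1).mono (Ici_subset_Ici.2 ht.1))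
    (fun t ht => mem_closedBall_zero_iff.2 ((hR t ⟨ht.1, ht.2.le⟩).trans (le_max_left _ _)))
    (hcont h' T) (fun t ht => (hflow h' t ht.1).mono (Ici_subset_Ici.2 ht.1))
    (fun t ht => mem_closedBall_zero_iff.2 ((hR' t ⟨ht.1, ht.2.le⟩).trans (le_max_right _ _)))
    (h.initial.trans h'.initial.symm) ⟨hT, le_rfl⟩

/-! ### The eigenvalue equations as one scalar equation. -/

/-- The solution of `u' = u ^ (p + 1)` with `u ^ (-p) = k` at time zero. -/
noncomputable def powerCurve (p : ℕ) (k τ : ℝ) : ℝ := (k - p * τ) ^ (-(p : ℝ)⁻¹)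

theorem powerCurve_pos {p : ℕ} {k τ : ℝ} (h : 0 < k - p * τ) : 0 < powerCurve p k τ :=
  Real.rpow_pos_of_pos h _

theorem powerCurve_pow {p : ℕ} (hp : p ≠ 0) {k τ : ℝ} (h : 0 < k - p * τ) :
    powerCurve p k τ ^ p = (k - p * τ)⁻¹ := by
  rw [powerCurve, Real.rpow_neg h.le, inv_pow, Real.rpow_inv_natCast_pow h.le hp]

theorem powerCurve_eq {p : ℕ} (hp : p ≠ 0) {k τ y : ℝ} (hy : 0 < y)
    (h : k - p * τ = (y ^ p)⁻¹) : powerCurve p k τ = y := by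
  rw [powerCurve, h, Real.rpow_neg (by positivity), Real.inv_rpow (by positivity), inv_inv,
    Real.pow_rpow_inv_natCast hy.le hp]

theorem hasDerivAt_powerCurve {p : ℕ} (hp : p ≠ 0) {k τ : ℝ} (h : 0 < k - p * τ) :
    HasDerivAt (powerCurve p k) (powerCurve p k τ ^ (p + 1)) τ := by
  have hp' : (p : ℝ) ≠ 0 := by exact_mod_cast hp
  have h1 : HasDerivAt (fun τ : ℝ => k - p * τ) (-p) τ := by
    simpa using ((hasDerivAt_id τ).const_mul (p : ℝ)).const_sub k
  refine (h1.rpow_const (p := -(p : ℝ)⁻¹) (Or.inl h.ne')).congr_deriv ?_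
  rw [pow_succ, powerCurve_pow hp h, powerCurve, Real.rpow_sub_one h.ne']
  field_simp

theorem powerCurve_le {p : ℕ} {k k' τ : ℝ} (h : 0 < k - p * τ) (hk : k ≤ k') :
    powerCurve p k' τ ≤ powerCurve p k τ :=
  Real.rpow_le_rpow_of_nonpos h (by linarith) (by simp)

/-- In reversed time the curve solves `u' = -u ^ (p + 1)`; this describes the eigenvalue `c`. -/
theorem tendsto_powerCurve_neg {p : ℕ} (hp : p ≠ 0) (k : ℝ) :
    Tendsto (fun t => powerCurve p k (-t)) atTop (𝓝 0) := by
  have hp' : (0 : ℝ) < p := by exact_mod_cast Nat.pos_of_ne_zero hp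
  have : Tendsto (fun t : ℝ => k - p * -t) atTop atTop := by
    simp only [mul_neg, sub_neg_eq_add]
    exact tendsto_atTop_add_const_left _ _ (tendsto_id.const_mul_atTop hp')
  exact (tendsto_rpow_neg_atTop (inv_pos.2 hp')).comp this

open Set in
/-- The coupled equations for the two observed eigenvalues of a factor have a global solution which
converges to a global minimum of the loss, and along which `x₂ ^ (-p) - x₁ ^ (-p)` is conserved. -/
theorem exists_eigenvalue_flow {p n : ℕ} (hp : p ≠ 0) (hn : 1 ≤ n) {v x₁ x₂ : ℝ} (hv : 0 < v)
    (hx₂ : 0 < x₂) (hx : x₂ ≤ x₁) :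
    ∃ (a b : ℝ → ℝ) (y₁ y₂ : ℝ), a 0 = x₁ ∧ b 0 = x₂ ∧
      (∀ t, 0 ≤ t → HasDerivWithinAt a (-(a t ^ (p + 1) *
        ((a t ^ (p + 2) - b t ^ (p + 2)) / n + b t ^ (p + 2) - v))) (Ici 0) t) ∧
      (∀ t, 0 ≤ t → HasDerivWithinAt b (-(b t ^ (p + 1) *
        ((a t ^ (p + 2) - b t ^ (p + 2)) / n + b t ^ (p + 2) - v))) (Ici 0) t) ∧
      Tendsto a atTop (𝓝 y₁) ∧ Tendsto b atTop (𝓝 y₂) ∧ 0 < y₁ ∧ 0 < y₂ ∧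
      (y₁ ^ (p + 2) - y₂ ^ (p + 2)) / n + y₂ ^ (p + 2) = v ∧
      (y₂ ^ p)⁻¹ - (y₁ ^ p)⁻¹ = (x₂ ^ p)⁻¹ - (x₁ ^ p)⁻¹ := by
  have hx₁ : 0 < x₁ := hx₂.trans_le hx
  have hn' : (1 : ℝ) ≤ n := by exact_mod_cast hn
  have hn0 : (0 : ℝ) < n := by linarith
  have hninv : (n : ℝ)⁻¹ ≤ 1 := inv_le_one_of_one_le₀ hn'
  have hninv0 : 0 < (n : ℝ)⁻¹ := inv_pos.2 hn0
  have hp' : (0 : ℝ) < p := by exact_mod_cast Nat.pos_of_ne_zero hp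
  set k₁ := (x₁ ^ p)⁻¹ with hk₁
  set k₂ := (x₂ ^ p)⁻¹ with hk₂
  have hk : k₁ ≤ k₂ := by
    rw [hk₁, hk₂]
    gcongr
  -- `F` is minus the residual in the new time `τ`. It decreases because both curves increase.
  set F : ℝ → ℝ := fun τ => v - ((powerCurve p k₁ τ ^ (p + 2) - powerCurve p k₂ τ ^ (p + 2)) / n +
    powerCurve p k₂ τ ^ (p + 2)) with hF
  set F' : ℝ → ℝ := fun τ => -(((p + 2 : ℕ) * (powerCurve p k₁ τ ^ (p + 1)) ^ 2) * (n : ℝ)⁻¹ +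
    ((p + 2 : ℕ) * (powerCurve p k₂ τ ^ (p + 1)) ^ 2) * (1 - (n : ℝ)⁻¹)) with hF'
  -- `T y` is the time at which the first curve takes the value `y`.
  set T : ℝ → ℝ := fun y => (k₁ - (y ^ p)⁻¹) / p with hT
  have hkT : ∀ y, k₁ - p * T y = (y ^ p)⁻¹ := by
    intro y
    rw [hT]
    field_simp
    ring
  -- The interval must contain time zero, hence `lo ≤ x₁ ≤ hi`. At `lo` the fitted value is at most
  -- `lo ^ (p + 2) ≤ v / 2`; at `hi` it exceeds `v`, since `hi ^ (p + 2) > n v`.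
  set lo := min x₁ (min 1 (v / 2)) with hlo
  set hi := max x₁ (n * v + 1) with hhi
  have hlo0 : 0 < lo := by positivity
  have hhi0 : 0 < hi := hx₁.trans_le (le_max_left _ _)
  have hd₁ : ∀ τ ∈ Icc (T lo) (T hi), 0 < k₁ - p * τ := by
    intro τ hτ
    have h1 := hkT hi
    have h2 : (p : ℝ) * τ ≤ p * T hi := mul_le_mul_of_nonneg_left hτ.2 hp'.le
    have h3 : 0 < (hi ^ p)⁻¹ := by positivity
    linarith
  -- As `k₁ ≤ k₂`, the second curve blows up no earlier than the first.
  have hd₂ : ∀ τ ∈ Icc (T lo) (T hi), 0 < k₂ - p * τ := fun τ hτ => by linarith [hd₁ τ hτ]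
  have hTlo : T lo ≤ 0 := by
    refine div_nonpos_of_nonpos_of_nonneg (sub_nonpos.2 ?_) hp'.le
    rw [hk₁]
    gcongr
    exact min_le_left _ _
  have hThi : 0 ≤ T hi := by
    refine div_nonneg (sub_nonneg.2 ?_) hp'.le
    rw [hk₁]
    gcongr
    exact le_max_left _ _
  have hFd : ∀ τ ∈ Icc (T lo) (T hi), HasDerivAt F (F' τ) τ := by
    intro τ hτ
    have h1 := (hasDerivAt_powerCurve hp (hd₁ τ hτ)).pow (p + 2)
    have h2 := (hasDerivAt_powerCurve hp (hd₂ τ hτ)).pow (p + 2)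
    refine ((((h1.sub h2).div_const (n : ℝ)).add h2).const_sub v).congr_deriv ?_
    simp only [hF', show p + 2 - 1 = p + 1 by omega]
    field_simp
    ring
  have hFc : ContinuousOn F' (Icc (T lo) (T hi)) := by
    have h1 : ContinuousOn (powerCurve p k₁) (Icc (T lo) (T hi)) := fun τ hτ =>
      (hasDerivAt_powerCurve hp (hd₁ τ hτ)).continuousAt.continuousWithinAt
    have h2 : ContinuousOn (powerCurve p k₂) (Icc (T lo) (T hi)) := fun τ hτ =>
      (hasDerivAt_powerCurve hp (hd₂ τ hτ)).continuousAt.continuousWithinAt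
    simp only [hF']
    fun_prop
  have hFneg : ∀ τ ∈ Icc (T lo) (T hi), F' τ < 0 := by
    intro τ hτ
    have h1 := powerCurve_pos (hd₁ τ hτ)
    have h2 := powerCurve_pos (hd₂ τ hτ)
    have h3 : 0 ≤ 1 - (n : ℝ)⁻¹ := by linarith
    exact neg_neg_of_pos (by positivity)
  have hlohi : T lo ≤ T hi := hTlo.trans hThi
  have hFlo : 0 < F (T lo) := by
    have h1 : powerCurve p k₁ (T lo) = lo := powerCurve_eq hp hlo0 (hkT lo)
    have h0 := (powerCurve_pos (hd₂ _ (left_mem_Icc.2 hlohi))).le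
    have h2 : powerCurve p k₂ (T lo) ^ (p + 2) ≤ lo ^ (p + 2) := by
      refine pow_le_pow_left₀ h0 ?_ _
      exact (powerCurve_le (hd₁ _ (left_mem_Icc.2 hlohi)) hk).trans_eq h1
    have h3 : lo ^ (p + 2) ≤ lo :=
      pow_le_of_le_one hlo0.le ((min_le_right _ _).trans (min_le_left _ _)) (by omega)
    have h4 : lo ≤ v / 2 := (min_le_right _ _).trans (min_le_right _ _)
    have h5 : (lo ^ (p + 2) - powerCurve p k₂ (T lo) ^ (p + 2)) / n ≤
        lo ^ (p + 2) - powerCurve p k₂ (T lo) ^ (p + 2) := div_le_self (by linarith) hn'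
    simp only [hF, h1]
    linarith
  have hFhi : F (T hi) < 0 := by
    have h1 : powerCurve p k₁ (T hi) = hi := powerCurve_eq hp hhi0 (hkT hi)
    have h0 := pow_pos (powerCurve_pos (hd₂ _ (right_mem_Icc.2 hlohi))) (p + 2)
    have h2 : n * v + 1 ≤ hi := le_max_right _ _
    have h3 : hi ≤ hi ^ (p + 2) := by
      refine le_self_pow₀ ?_ (by omega)
      have : 0 < n * v := by positivity
      linarith
    have h4 : v < hi ^ (p + 2) / n := by
      rw [lt_div_iff₀ hn0]
      linarith
    have h5 : powerCurve p k₂ (T hi) ^ (p + 2) / n ≤ powerCurve p k₂ (T hi) ^ (p + 2) :=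
      div_le_self h0.le hn'
    simp only [hF, h1, sub_div]
    linarith
  obtain ⟨x, y, hx0, hmem, hder, hy, hFy, hlim⟩ :=
    exists_solution_tendsto_zero_of_deriv_neg hTlo hThi hFd hFc hFneg hFlo hFhi
  refine ⟨fun t => powerCurve p k₁ (x t), fun t => powerCurve p k₂ (x t), powerCurve p k₁ y,
    powerCurve p k₂ y, ?_, ?_, ?_, ?_, ?_, ?_, powerCurve_pos (hd₁ y hy),
    powerCurve_pos (hd₂ y hy), ?_, ?_⟩
  · exact powerCurve_eq hp hx₁ (by rw [hx0]; simp [hk₁])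
  · exact powerCurve_eq hp hx₂ (by rw [hx0]; simp [hk₂])
  · intro t ht
    refine ((hasDerivAt_powerCurve hp (hd₁ _ (hmem t ht))).comp_hasDerivWithinAt t
      (hder t ht)).congr_deriv ?_
    simp only [hF]
    ring
  · intro t ht
    refine ((hasDerivAt_powerCurve hp (hd₂ _ (hmem t ht))).comp_hasDerivWithinAt t
      (hder t ht)).congr_deriv ?_
    simp only [hF]
    ring
  · exact (hasDerivAt_powerCurve hp (hd₁ y hy)).continuousAt.tendsto.comp hlim
  · exact (hasDerivAt_powerCurve hp (hd₂ y hy)).continuousAt.tendsto.comp hlim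
  · simp only [hF] at hFy
    linarith
  · rw [powerCurve_pow hp (hd₁ y hy), powerCurve_pow hp (hd₂ y hy)]
    simp

/-! ### Limits of spectral matrices and the stable rank. -/

theorem spectralMatrix_apply (s n : ℕ) (a b c : ℝ) (i j : Fin (s * n)) :
    spectralMatrix s n a b c i j = (a - b) / (s * n) * allOnes (s * n) i j +
      (b - c) / s * blockOnes s n i j + c * (1 : Matrix (Fin (s * n)) (Fin (s * n)) ℝ) i j := by
  simp [spectralMatrix]

theorem hasDerivWithinAt_spectralMatrix_apply (s n : ℕ) {a b c : ℝ → ℝ} {a' b' c' t : ℝ}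
    {S : Set ℝ} (ha : HasDerivWithinAt a (-a') S t) (hb : HasDerivWithinAt b (-b') S t)
    (hc : HasDerivWithinAt c (-c') S t) (i j : Fin (s * n)) :
    HasDerivWithinAt (fun t => spectralMatrix s n (a t) (b t) (c t) i j)
      (-spectralMatrix s n a' b' c' i j) S t := by
  simp only [spectralMatrix_apply]
  refine (((((ha.sub hb).div_const _).mul_const _).add
    (((hb.sub hc).div_const _).mul_const _)).add (hc.mul_const _)).congr_deriv ?_
  ring

theorem tendsto_spectralMatrix (s n : ℕ) {ι : Type*} {l : Filter ι} {a b c : ι → ℝ}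
    {a' b' c' : ℝ} (ha : Tendsto a l (𝓝 a')) (hb : Tendsto b l (𝓝 b'))
    (hc : Tendsto c l (𝓝 c')) :
    Tendsto (fun t => spectralMatrix s n (a t) (b t) (c t)) l
      (𝓝 (spectralMatrix s n a' b' c')) := by
  refine tendsto_pi_nhds.2 fun i => tendsto_pi_nhds.2 fun j => ?_
  simp only [spectralMatrix_apply]
  exact ((((ha.sub hb).div_const _).mul_const _).add
    (((hb.sub hc).div_const _).mul_const _)).add (hc.mul_const _)

/-- The C*-identity gives `‖a‖² = ‖a * a‖ = d ‖a‖`. -/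
theorem norm_eq_natCast_of_star_eq_of_mul_self_eq_smul {A : Type*} [NormedRing A]
    [NormedAlgebra ℝ A] [StarRing A] [CStarRing A] {a : A} {d : ℕ} (hstar : star a = a)
    (hmul : a * a = (d : ℝ) • a) (hne : a ≠ 0) : ‖a‖ = d := by
  have h : ‖star a * a‖ = ‖a‖ * ‖a‖ := CStarRing.norm_star_mul_self
  rw [hstar, hmul, norm_smul, Real.norm_natCast] at h
  exact (mul_right_cancel₀ (norm_ne_zero_iff.2 hne) h).symm

theorem norm_toEuclideanCLM_allOnes {d : ℕ} (hd : 0 < d) :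
    ‖Matrix.toEuclideanCLM (𝕜 := ℝ) (allOnes d)‖ = d := by
  refine norm_eq_natCast_of_star_eq_of_mul_self_eq_smul ?_ ?_ ?_
  · rw [← map_star, Matrix.star_eq_conjTranspose, Matrix.conjTranspose_eq_transpose_of_trivial,
      transpose_allOnes]
  · rw [← map_mul, allOnes_mul_allOnes, map_smul]
  · rw [Ne, EmbeddingLike.map_eq_zero_iff]
    intro h
    have := congrFun (congrFun h ⟨0, hd⟩) ⟨0, hd⟩
    simp [allOnes] at this

theorem continuous_toEuclideanCLM (d : ℕ) :
    Continuous fun W : Matrix (Fin d) (Fin d) ℝ => Matrix.toEuclideanCLM (𝕜 := ℝ) W :=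
  (Matrix.toEuclideanCLM (n := Fin d) (𝕜 := ℝ)).toAlgEquiv.toLinearMap.continuous_of_finiteDimensional

/-- Numerator and denominator are continuous and both equal `w² d²` at the limit, which is nonzero.
-/
theorem tendsto_stableRank_of_tendsto_smul_allOnes {d : ℕ} (hd : 0 < d) {w : ℝ} (hw : w ≠ 0)
    {ι : Type*} {l : Filter ι} {M : ι → Matrix (Fin d) (Fin d) ℝ}
    (hM : Tendsto M l (𝓝 (w • allOnes d))) :
    Tendsto (fun t => stableRank (M t)) l (𝓝 1) := by
  have hd' : (d : ℝ) ≠ 0 := by positivity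
  have hnorm : ‖Matrix.toEuclideanCLM (𝕜 := ℝ) (w • allOnes d)‖ = |w| * d := by
    rw [map_smul, norm_smul, norm_toEuclideanCLM_allOnes hd, Real.norm_eq_abs]
  have hone : (1 : ℝ) = (∑ i, ∑ j, (w • allOnes d) i j ^ 2) /
      ‖Matrix.toEuclideanCLM (𝕜 := ℝ) (w • allOnes d)‖ ^ 2 := by
    rw [hnorm, mul_pow, sq_abs]
    simp [allOnes]
    field_simp
  rw [hone]
  refine Tendsto.div ?_ ((((continuous_toEuclideanCLM d).tendsto _).comp hM).norm.pow 2) ?_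
  · refine tendsto_finsetSum _ fun i _ => tendsto_finsetSum _ fun j _ => Tendsto.pow ?_ 2
    exact tendsto_pi_nhds.1 (tendsto_pi_nhds.1 hM i) j
  · rw [hnorm]
    positivity

/-! ### The explicit flow and the limit of small initialization. -/

/-- The explicit solution of the gradient flow with factors of the form `spectralMatrix`, and its
limit. -/
theorem exists_gradientFlow_tendsto {s n L : ℕ} (hs : 1 ≤ s) (hn : 1 ≤ n) (hL : 3 ≤ L) {w : ℝ}
    (hw : 0 < w) {Wstar : Matrix (Fin (s * n)) (Fin (s * n)) ℝ}
    (hWstar : ∀ p ∈ blockObs s n, Wstar p.1 p.2 = w) {x₁ x₂ x₃ : ℝ} (hx₂ : 0 < x₂) (hx : x₂ ≤ x₁)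
    (hx₃ : 0 < x₃) :
    ∃ (W : ℝ → Fin L → Matrix (Fin (s * n)) (Fin (s * n)) ℝ) (y₁ y₂ : ℝ),
      IsGradientFlow (blockObs s n) Wstar (fun _ => spectralMatrix s n x₁ x₂ x₃) W ∧
      Tendsto (fun t => endToEnd (W t)) atTop (𝓝 (spectralMatrix s n (y₁ ^ L) (y₂ ^ L) 0)) ∧
      0 < y₁ ∧ 0 < y₂ ∧ (y₁ ^ L - y₂ ^ L) / n + y₂ ^ L = s * w ∧
      (y₂ ^ (L - 2))⁻¹ - (y₁ ^ (L - 2))⁻¹ = (x₂ ^ (L - 2))⁻¹ - (x₁ ^ (L - 2))⁻¹ := by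
  obtain ⟨p, rfl⟩ : ∃ p, L = p + 2 := ⟨L - 2, by omega⟩
  have hp : p ≠ 0 := by omega
  have hs' : (0 : ℝ) < s := by positivity
  obtain ⟨a, b, y₁, y₂, ha0, hb0, ha, hb, hay, hby, hy₁, hy₂, heq, hcons⟩ :=
    exists_eigenvalue_flow hp hn (mul_pos hs' hw) hx₂ hx
  have hq : 2 * p + 2 ≠ 0 := by omega
  -- With `L = p + 2` the third equation is `c' = -c ^ (2L - 1)`, so the curve has parameter `2L - 2
  -- = 2p + 2`.
  have hc : ∀ t, 0 ≤ t → HasDerivWithinAt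
      (fun t => powerCurve (2 * p + 2) (x₃ ^ (2 * p + 2))⁻¹ (-t))
      (-(powerCurve (2 * p + 2) (x₃ ^ (2 * p + 2))⁻¹ (-t) ^ (p + 2 - 1) *
        powerCurve (2 * p + 2) (x₃ ^ (2 * p + 2))⁻¹ (-t) ^ (p + 2))) (Set.Ici 0) t := by
    intro t ht
    have hpos : 0 < (x₃ ^ (2 * p + 2))⁻¹ - (2 * p + 2 : ℕ) * -t := by
      have : 0 < (x₃ ^ (2 * p + 2))⁻¹ := by positivity
      have : 0 ≤ ((2 * p + 2 : ℕ) : ℝ) * t := by positivity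
      linarith
    refine ((hasDerivAt_powerCurve hq hpos).comp t (hasDerivAt_neg t)).hasDerivWithinAt.congr_deriv
      ?_
    rw [← pow_add, show p + 2 - 1 + (p + 2) = 2 * p + 2 + 1 by omega]
    ring
  set c := fun t => powerCurve (2 * p + 2) (x₃ ^ (2 * p + 2))⁻¹ (-t) with hcdef
  have hc0 : c 0 = x₃ := powerCurve_eq hq hx₃ (by simp)
  have hclim : Tendsto c atTop (𝓝 0) := tendsto_powerCurve_neg hq _
  refine ⟨fun t _ => spectralMatrix s n (a t) (b t) (c t), y₁, y₂, ⟨?_, ?_⟩, ?_, hy₁, hy₂, heq,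
    by simpa using hcons⟩
  · rw [ha0, hb0, hc0]
  · intro t ht l i j
    rw [lossGrad_spectralMatrix hs hn hWstar]
    exact hasDerivWithinAt_spectralMatrix_apply s n (ha t ht) (hb t ht) (hc t ht) i j
  · simp only [endToEnd_const, spectralMatrix_pow hs hn]
    refine tendsto_spectralMatrix s n (hay.pow _) (hby.pow _) ?_
    simpa using hclim.pow (p + 2)

/-- If `y₂ ^ (-p) - y₁ ^ (-p)` is a positive multiple of `α ^ (-p)`, then `y₂ → 0` with `α`. -/
theorem tendsto_zero_of_inv_pow_sub_inv_pow {p : ℕ} (hp : p ≠ 0) {c : ℝ} (hc : 0 < c)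
    {y₁ y₂ : ℝ → ℝ} (h₁ : ∀ α, 0 < α → 0 < y₁ α) (h₂ : ∀ α, 0 < α → 0 < y₂ α)
    (h : ∀ α, 0 < α → (y₂ α ^ p)⁻¹ - (y₁ α ^ p)⁻¹ = c * (α ^ p)⁻¹) :
    Tendsto y₂ (𝓝[>] 0) (𝓝 0) := by
  -- Dropping the positive term in `y₁` leaves a bound on `y₂` alone.
  have hbound : ∀ α, 0 < α → y₂ α ^ p ≤ α ^ p / c := by
    intro α hα
    have h1 : 0 < (y₁ α ^ p)⁻¹ := inv_pos.2 (pow_pos (h₁ α hα) p)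
    have h2 : c * (α ^ p)⁻¹ ≤ (y₂ α ^ p)⁻¹ := by linarith [h α hα]
    have h3 := inv_anti₀ (by positivity) h2
    rwa [inv_inv, mul_inv, inv_inv, mul_comm, ← div_eq_mul_inv] at h3
  have hlim : Tendsto (fun α : ℝ => α ^ p / c) (𝓝[>] 0) (𝓝 0) := by
    have : Tendsto (fun α : ℝ => α ^ p / c) (𝓝 0) (𝓝 (0 ^ p / c)) :=
      (tendsto_id.pow p).div_const c
    rw [zero_pow hp, zero_div] at this
    exact this.mono_left nhdsWithin_le_nhds
  have hpow : Tendsto (fun α => y₂ α ^ p) (𝓝[>] 0) (𝓝 0) := by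
    refine tendsto_of_tendsto_of_tendsto_of_le_of_le' tendsto_const_nhds hlim ?_ ?_
    · filter_upwards [self_mem_nhdsWithin] with α hα using (pow_pos (h₂ α hα) p).le
    · filter_upwards [self_mem_nhdsWithin] with α hα using hbound α hα
  have hp' : (0 : ℝ) < (p : ℝ)⁻¹ := by positivity
  have hroot := hpow.rpow_const (p := (p : ℝ)⁻¹) (Or.inr hp'.le)
  rw [Real.zero_rpow hp'.ne'] at hroot
  refine hroot.congr' ?_
  filter_upwards [self_mem_nhdsWithin] with α hα
  exact Real.pow_rpow_inv_natCast (h₂ α hα).le hp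

end DeepCompletion

theorem corollary3p4 (m : ℝ) (hm : 1 < m) (n : ℕ) (hn : 2 ≤ n) (s : ℕ) (hs : 1 ≤ s)
    (w : ℝ) (hw : 0 < w) (L : ℕ) (hL : 3 ≤ L)
    (Wstar : Matrix (Fin (s * n)) (Fin (s * n)) ℝ)
    (hWstar : ∀ p ∈ DeepCompletion.blockObs s n, Wstar p.1 p.2 = w) :
    ∃ Winf : ℝ → Matrix (Fin (s * n)) (Fin (s * n)) ℝ,
      (∀ α : ℝ, 0 < α →
        (∃ W : ℝ → Fin L → Matrix (Fin (s * n)) (Fin (s * n)) ℝ,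
          DeepCompletion.IsGradientFlow (DeepCompletion.blockObs s n) Wstar
            (fun _ => DeepCompletion.initFactor (s * n) α m) W) ∧
        (∀ W : ℝ → Fin L → Matrix (Fin (s * n)) (Fin (s * n)) ℝ,
          DeepCompletion.IsGradientFlow (DeepCompletion.blockObs s n) Wstar
            (fun _ => DeepCompletion.initFactor (s * n) α m) W →
          Tendsto (fun t : ℝ => DeepCompletion.endToEnd (W t)) atTop (𝓝 (Winf α)))) ∧
      Tendsto (fun α : ℝ => DeepCompletion.stableRank (Winf α)) (𝓝[>] 0) (𝓝 1) := by
  open DeepCompletion in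
  have hn1 : 1 ≤ n := by omega
  have hs' : (0 : ℝ) < s := by positivity
  have hn' : (0 : ℝ) < n := by positivity
  have hm0 : 0 < m := by linarith
  have hp : L - 2 ≠ 0 := by omega
  -- The initial eigenvalues are `α β₁` on constants and `α β₂` elsewhere; `m > 1` makes `β₂`
  -- positive.
  set β₂ := 1 - 1 / m with hβ₂
  set β₁ := 1 - 1 / m + s * n / m with hβ₁
  have hβ₂0 : 0 < β₂ := by
    rw [hβ₂, sub_pos, div_lt_one hm0]
    exact hm
  have hβ : β₂ < β₁ := by
    have : 0 < s * n / m := by positivity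
    linarith
  have hinit : ∀ α, initFactor (s * n) α m = spectralMatrix s n (α * β₁) (α * β₂) (α * β₂) := by
    intro α
    rw [initFactor_eq_spectralMatrix hs hn1]
    congr 1
    · rw [hβ₁]; ring
    · rw [hβ₂]; ring
    · rw [hβ₂]; ring
  -- The positivity of `α` sits inside the existential so that `choose` yields functions on all of
  -- `ℝ`; other `α` get zero values.
  have hex : ∀ α : ℝ, ∃ (W : ℝ → Fin L → Matrix (Fin (s * n)) (Fin (s * n)) ℝ) (y₁ y₂ : ℝ),
      0 < α → IsGradientFlow (blockObs s n) Wstar (fun _ => initFactor (s * n) α m) W ∧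
        Tendsto (fun t => endToEnd (W t)) atTop (𝓝 (spectralMatrix s n (y₁ ^ L) (y₂ ^ L) 0)) ∧
        0 < y₁ ∧ 0 < y₂ ∧ (y₁ ^ L - y₂ ^ L) / n + y₂ ^ L = s * w ∧
        (y₂ ^ (L - 2))⁻¹ - (y₁ ^ (L - 2))⁻¹ =
          ((β₂ ^ (L - 2))⁻¹ - (β₁ ^ (L - 2))⁻¹) * (α ^ (L - 2))⁻¹ := by
    intro α
    by_cases hα : 0 < α
    · obtain ⟨W, y₁, y₂, h1, h2, h3, h4, h5, h6⟩ := exists_gradientFlow_tendsto hs hn1 hL hw hWstar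
        (mul_pos hα hβ₂0) (mul_le_mul_of_nonneg_left hβ.le hα.le) (mul_pos hα hβ₂0)
      refine ⟨W, y₁, y₂, fun _ => ⟨by rwa [hinit], h2, h3, h4, h5, ?_⟩⟩
      rw [h6, mul_pow, mul_pow, mul_inv, mul_inv]
      ring
    · exact ⟨0, 0, 0, fun h => absurd h hα⟩
  choose W y₁ y₂ hW using hex
  refine ⟨fun α => spectralMatrix s n (y₁ α ^ L) (y₂ α ^ L) 0, fun α hα =>
    ⟨⟨W α, (hW α hα).1⟩, fun V hV => ?_⟩, ?_⟩
  · refine (hW α hα).2.1.congr' ?_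
    filter_upwards [eventually_ge_atTop 0] with t ht
    rw [(hW α hα).1.eqOn hV ht]
  · have hc : 0 < (β₂ ^ (L - 2))⁻¹ - (β₁ ^ (L - 2))⁻¹ :=
      sub_pos.2 (inv_strictAnti₀ (by positivity) (pow_lt_pow_left₀ hβ hβ₂0.le hp))
    have hy₂ : Tendsto y₂ (𝓝[>] 0) (𝓝 0) := tendsto_zero_of_inv_pow_sub_inv_pow hp hc
      (fun α hα => (hW α hα).2.2.1) (fun α hα => (hW α hα).2.2.2.1)
      fun α hα => (hW α hα).2.2.2.2.2
    have hy₂L : Tendsto (fun α => y₂ α ^ L) (𝓝[>] 0) (𝓝 0) := by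
      simpa [show L ≠ 0 by omega] using hy₂.pow L
    -- Zero residual, solved for `y₁ ^ L`.
    have hy₁L : Tendsto (fun α => y₁ α ^ L) (𝓝[>] 0) (𝓝 (n * (s * w))) := by
      have : Tendsto (fun α => n * (s * w - y₂ α ^ L) + y₂ α ^ L) (𝓝[>] 0)
          (𝓝 (n * (s * w - 0) + 0)) := ((hy₂L.const_sub _).const_mul _).add hy₂L
      rw [sub_zero, add_zero] at this
      refine this.congr' ?_
      filter_upwards [self_mem_nhdsWithin] with α hα
      rw [← (hW α hα).2.2.2.2.1]
      field_simp
      ring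
    have hlim := tendsto_spectralMatrix s n hy₁L hy₂L (tendsto_const_nhds (x := (0 : ℝ)))
    have hval : spectralMatrix s n (n * (s * w)) 0 0 = w • allOnes (s * n) := by
      simp only [spectralMatrix, sub_zero, zero_div, zero_smul, add_zero]
      congr 1
      field_simp
    rw [hval] at hlim
    exact tendsto_stableRank_of_tendsto_smul_allOnes (by positivity) hw.ne' hlim
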